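/- Let $F$ be any subfield of $\mathbb{R}$. For $a \in F$ let $f_a$ be a unary function symbol, interpreted in $\mathbb{R}$ by $f_a(x) = ax$. Let $T_{\mathrm{add}}[F]$ be the set of all first-order sentences in the language $0, 1, +, -, <, (f_a)_{a \in F}$ that are true in $\mathbb{R}$, let $T_{\mathrm{mult}}[F]$ be the set of all first-order sentences in the language $0, 1, \times, \div, <, (f_a)_{a \in F}$ that are true in $\mathbb{R}$ (where $x \div 0 = 0$), and let $T[F] = T_{\mathrm{add}}[F] \cup T_{\mathrm{mult}}[F]$, a theory in the union of the two languages. "Proves" means derivability in classical first-order logic with equality. Write $x^2$ for $x \times x$, $2x$ for $f_2(x)$, and, for $a \in F$, write $a$ also for the term $f_a(1)$. Then: 1. For every $\varepsilon \in F$, $T[F]$ proves $\forall x\,(x^2 - 2x + 1 \geq \varepsilon)$ if and only if $\varepsilon < 0$. In particular, $T[F]$ does not prove $\forall x\,(x^2 - 2x + 1 \geq 0)$. 2. For every $r \in F$, $T[F]$ proves $\forall x\,(x \leq r \rightarrow x^2 - 2x + 1 \geq 0)$ if and only if $r < 1$. 3. For every $r \in F$, $T[F]$ proves $\forall x\,(x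 \geq r \rightarrow x^2 - 2x + 1 \geq 0)$ if and only if $r > 1$. -/

import Mathlib

namespace RealFragments

open FirstOrder FirstOrder.Language

section Calculus

/-! ### Classical natural deduction with equality

Formulas are Mathlib's `BoundedFormula`s: an element of `L.BoundedFormula α n` is a formula whose
free variables are indexed by `α` and by `Fin n`; a sentence is the case `α = Empty`, `n = 0`. -/

variable {L : FirstOrder.Language.{0, 0}} {α : Type}

/-- Extend a substitution under a quantifier: the newly bound variable is sent to itself. -/
def liftSubst {n m : ℕ} (σ : Fin n → L.Term (α ⊕ Fin m)) : Fin (n + 1) → L.Term (α ⊕ Fin (m + 1)) :=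
  Fin.snoc (α := fun _ => L.Term (α ⊕ Fin (m + 1)))
    (fun i => (σ i).relabel (Sum.map id Fin.castSucc)) (Term.var (Sum.inr (Fin.last m)))

/-- Substitution in a term of terms for the variables indexed by `Fin n`. -/
def substTerm {n m : ℕ} (σ : Fin n → L.Term (α ⊕ Fin m)) (t : L.Term (α ⊕ Fin n)) :
    L.Term (α ⊕ Fin m) :=
  t.subst (Sum.elim (fun a => Term.var (Sum.inl a)) σ)

/-- Simultaneous capture-avoiding substitution in a formula of terms for the variables indexed
by `Fin n`. -/
def substFormula : {n m : ℕ} → (Fin n → L.Term (α ⊕ Fin m)) → L.BoundedFormula α n →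
    L.BoundedFormula α m
  | _, _, _, .falsum => .falsum
  | _, _, σ, .equal s t => .equal (substTerm σ s) (substTerm σ t)
  | _, _, σ, .rel R ts => .rel R (fun i => substTerm σ (ts i))
  | _, _, σ, .imp φ ψ => .imp (substFormula σ φ) (substFormula σ ψ)
  | _, _, σ, .all φ => .all (substFormula (liftSubst σ) φ)

/-- `φ(t)`: substitute `t` for the last variable of `φ`. -/
def instLast {n : ℕ} (φ : L.BoundedFormula α (n + 1)) (t : L.Term (α ⊕ Fin n)) :
    L.BoundedFormula α n :=
  substFormula (Fin.snoc (α := fun _ => L.Term (α ⊕ Fin n))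
    (fun i => Term.var (Sum.inr i)) t) φ

/-- Regard `φ` as a formula with one more (fresh) variable, which does not occur in it. -/
def weaken {n : ℕ} (φ : L.BoundedFormula α n) : L.BoundedFormula α (n + 1) :=
  substFormula (fun i => Term.var (Sum.inr i.castSucc)) φ

/-- `Derivable Γ φ`: the formula `φ` has a proof from the set of hypotheses `Γ` in classical
first-order natural deduction with equality. -/
inductive Derivable : {n : ℕ} → Set (L.BoundedFormula α n) → L.BoundedFormula α n → Prop
  | hyp {n : ℕ} {Γ : Set (L.BoundedFormula α n)} {φ : L.BoundedFormula α n} :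
      φ ∈ Γ → Derivable Γ φ
  | impIntro {n : ℕ} {Γ : Set (L.BoundedFormula α n)} {φ ψ : L.BoundedFormula α n} :
      Derivable (insert φ Γ) ψ → Derivable Γ (φ.imp ψ)
  | impElim {n : ℕ} {Γ : Set (L.BoundedFormula α n)} {φ ψ : L.BoundedFormula α n} :
      Derivable Γ (φ.imp ψ) → Derivable Γ φ → Derivable Γ ψ
  | byContradiction {n : ℕ} {Γ : Set (L.BoundedFormula α n)} {φ : L.BoundedFormula α n} :
      Derivable (insert φ.not Γ) .falsum → Derivable Γ φ
  | allIntro {n : ℕ} {Γ : Set (L.BoundedFormula α n)} {φ : L.BoundedFormula α (n + 1)} :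
      Derivable (weaken '' Γ) φ → Derivable Γ φ.all
  | allElim {n : ℕ} {Γ : Set (L.BoundedFormula α n)} {φ : L.BoundedFormula α (n + 1)}
      (t : L.Term (α ⊕ Fin n)) :
      Derivable Γ φ.all → Derivable Γ (instLast φ t)
  | eqRefl {n : ℕ} {Γ : Set (L.BoundedFormula α n)} (t : L.Term (α ⊕ Fin n)) :
      Derivable Γ (.equal t t)
  | eqSubst {n : ℕ} {Γ : Set (L.BoundedFormula α n)} (φ : L.BoundedFormula α (n + 1))
      {s t : L.Term (α ⊕ Fin n)} :
      Derivable Γ (.equal s t) → Derivable Γ (instLast φ s) → Derivable Γ (instLast φ t)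

/-- The theory `T` proves the sentence `φ`. -/
def Proves (T : L.Theory) (φ : L.Sentence) : Prop := Derivable T φ

end Calculus

/-! ### The theories `T_add[F]`, `T_mult[F]` and `T[F]` -/

/-- The only relation symbol (besides equality): the binary symbol `<`. -/
inductive OrdRel : ℕ → Type
  | lt : OrdRel 2

/-- Function symbols `0, 1, f_a (a ∈ F), +, -`. -/
inductive AddFunc (F : Subfield ℝ) : ℕ → Type
  | zero : AddFunc F 0
  | one : AddFunc F 0
  | scale (a : F) : AddFunc F 1
  | add : AddFunc F 2
  | sub : AddFunc F 2

/-- Function symbols `0, 1, f_a (a ∈ F), ×, ÷`. -/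
inductive MultFunc (F : Subfield ℝ) : ℕ → Type
  | zero : MultFunc F 0
  | one : MultFunc F 0
  | scale (a : F) : MultFunc F 1
  | mul : MultFunc F 2
  | div : MultFunc F 2

/-- Function symbols `0, 1, f_a (a ∈ F), +, -, ×, ÷`. -/
inductive FullFunc (F : Subfield ℝ) : ℕ → Type
  | zero : FullFunc F 0
  | one : FullFunc F 0
  | scale (a : F) : FullFunc F 1
  | add : FullFunc F 2
  | sub : FullFunc F 2
  | mul : FullFunc F 2
  | div : FullFunc F 2

/-- The additive language `0, 1, +, -, <, f_a`. -/
def addLang (F : Subfield ℝ) : FirstOrder.Language.{0, 0} := ⟨AddFunc F, OrdRel⟩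

/-- The multiplicative language `0, 1, ×, ÷, <, f_a`. -/
def multLang (F : Subfield ℝ) : FirstOrder.Language.{0, 0} := ⟨MultFunc F, OrdRel⟩

/-- The union of the additive and the multiplicative language. -/
def fullLang (F : Subfield ℝ) : FirstOrder.Language.{0, 0} := ⟨FullFunc F, OrdRel⟩

/-- The reals as a structure for the additive language, with `f_a(x) = a x`. -/
noncomputable instance addStructure (F : Subfield ℝ) : (addLang F).Structure ℝ where
  funMap := fun {n} (f : AddFunc F n) =>
    match n, f with
    | _, .zero => fun _ => 0
    | _, .one => fun _ => 1
    | _, .scale a => fun v => (a : ℝ) * v 0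
    | _, .add => fun v => v 0 + v 1
    | _, .sub => fun v => v 0 - v 1
  RelMap := fun {n} (R : OrdRel n) =>
    match n, R with
    | _, .lt => fun v => v 0 < v 1

/-- The reals as a structure for the multiplicative language, with `f_a(x) = a x`
and `x ÷ 0 = 0`. -/
noncomputable instance multStructure (F : Subfield ℝ) : (multLang F).Structure ℝ where
  funMap := fun {n} (f : MultFunc F n) =>
    match n, f with
    | _, .zero => fun _ => 0
    | _, .one => fun _ => 1
    | _, .scale a => fun v => (a : ℝ) * v 0
    | _, .mul => fun v => v 0 * v 1
    | _, .div => fun v => v 0 / v 1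
  RelMap := fun {n} (R : OrdRel n) =>
    match n, R with
    | _, .lt => fun v => v 0 < v 1

/-- The inclusion of the additive language in the full language. -/
def addHom (F : Subfield ℝ) : addLang F →ᴸ fullLang F where
  onFunction := fun {n} (f : AddFunc F n) =>
    match n, f with
    | _, .zero => FullFunc.zero
    | _, .one => FullFunc.one
    | _, .scale a => FullFunc.scale a
    | _, .add => FullFunc.add
    | _, .sub => FullFunc.sub
  onRelation := fun {_} (R : OrdRel _) => R

/-- The inclusion of the multiplicative language in the full language. -/
def multHom (F : Subfield ℝ) : multLang F →ᴸ fullLang F where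
  onFunction := fun {n} (f : MultFunc F n) =>
    match n, f with
    | _, .zero => FullFunc.zero
    | _, .one => FullFunc.one
    | _, .scale a => FullFunc.scale a
    | _, .mul => FullFunc.mul
    | _, .div => FullFunc.div
  onRelation := fun {_} (R : OrdRel _) => R

/-- `T_add[F]`: all sentences of the additive language that are true in the reals. -/
def theoryAdd (F : Subfield ℝ) : (addLang F).Theory := (addLang F).completeTheory ℝ

/-- `T_mult[F]`: all sentences of the multiplicative language that are true in the reals. -/
def theoryMult (F : Subfield ℝ) : (multLang F).Theory := (multLang F).completeTheory ℝ

/-- `T[F] = T_add[F] ∪ T_mult[F]`, in the full language. -/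
def theoryT (F : Subfield ℝ) : (fullLang F).Theory :=
  (addHom F).onTheory (theoryAdd F) ∪ (multHom F).onTheory (theoryMult F)

/-! ### Terms and formulas of the full language -/

section Formulas

variable {F : Subfield ℝ} {β : Type} {n : ℕ}

/-- The constant `0`. -/
def zeroT : (fullLang F).Term β := Term.func (FullFunc.zero : (fullLang F).Functions 0) ![]

/-- The constant `1`. -/
def oneT : (fullLang F).Term β := Term.func (FullFunc.one : (fullLang F).Functions 0) ![]

/-- `f_a(t)`. -/
def scaleT (a : F) (t : (fullLang F).Term β) : (fullLang F).Term β :=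
  Term.func (FullFunc.scale a : (fullLang F).Functions 1) ![t]

/-- `s + t`. -/
def addT (s t : (fullLang F).Term β) : (fullLang F).Term β :=
  Term.func (FullFunc.add : (fullLang F).Functions 2) ![s, t]

/-- `s - t`. -/
def subT (s t : (fullLang F).Term β) : (fullLang F).Term β :=
  Term.func (FullFunc.sub : (fullLang F).Functions 2) ![s, t]

/-- `s × t`. -/
def mulT (s t : (fullLang F).Term β) : (fullLang F).Term β :=
  Term.func (FullFunc.mul : (fullLang F).Functions 2) ![s, t]

/-- The term `f_a(1)` that denotes the element `a` of `F`. -/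
def constT (a : F) : (fullLang F).Term β := scaleT a oneT

/-- `s < t`. -/
def ltF (s t : (fullLang F).Term (Empty ⊕ Fin n)) : (fullLang F).BoundedFormula Empty n :=
  BoundedFormula.rel (OrdRel.lt : (fullLang F).Relations 2) ![s, t]

/-- `s ≤ t`, that is, `s < t ∨ s = t`; `t ≥ s` is the same formula. -/
def leF (s t : (fullLang F).Term (Empty ⊕ Fin n)) : (fullLang F).BoundedFormula Empty n :=
  ltF s t ⊔ BoundedFormula.equal s t

/-- The variable `x`. -/
def varX : (fullLang F).Term (Empty ⊕ Fin 1) := Term.var (Sum.inr 0)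

/-- The term `x² - 2x + 1`, that is, `((x × x) - f_2(x)) + 1`. -/
noncomputable def quadT : (fullLang F).Term (Empty ⊕ Fin 1) :=
  addT (subT (mulT varX varX) (scaleT 2 varX)) oneT

/-- The sentence `∀ x (x² - 2x + 1 ≥ ε)`. -/
noncomputable def quadGe (ε : F) : (fullLang F).Sentence := (leF (constT ε) quadT).all

/-- The sentence `∀ x (x² - 2x + 1 ≥ 0)`. -/
noncomputable def quadNonneg (F : Subfield ℝ) : (fullLang F).Sentence := (leF zeroT quadT).all

/-- The sentence `∀ x (x ≤ r → x² - 2x + 1 ≥ 0)`. -/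
noncomputable def quadNonnegBelow (r : F) : (fullLang F).Sentence :=
  ((leF varX (constT r)).imp (leF zeroT quadT)).all

/-- The sentence `∀ x (x ≥ r → x² - 2x + 1 ≥ 0)`. -/
noncomputable def quadNonnegAbove (r : F) : (fullLang F).Sentence :=
  ((leF (constT r) varX).imp (leF zeroT quadT)).all

end Formulas

end RealFragments

/-! Negative half: by soundness it suffices to find a model of `T[F]` in which $x^2-2x+1$ is
negative at $1\pm\epsilon$ for an infinitesimal $\epsilon$. Keep the order and addition of the
hyperreals, and transport multiplication along an order automorphism $h$ that fixes $0$ and $1$ and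
commutes with every $f_a$, $a \in F$. The additive reduct is then an ultrapower of the reals, and
the multiplicative reduct is isomorphic to one through $h$, so `T[F]` holds (`twisted_model`). On
the halo of each nonzero $a \in F$ put $h(x) = a^2/(2a-x)$, elsewhere $h(x) = x$. Near $1$ the new
square is $2-(2-x)^2$, so $x^2-2x+1$ takes the value $-(x-1)^2$ (`realize_quadT`).

Positive half: an interpolant $\varphi(x,y)$ in the common symbols $1, <, f_a$ passes information
from one theory to the other (`proves_of_interpolant`). Multiplicatively, $y = x \times x$ gives $y
\ge 0$ and $c \le x \to cx \le y$ for each $c$ in a finite grid in $[0,2]$. Additively, these linear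
facts bound $y-2x+1$ below by $1$ or by $(x-1)^2-2/N$ (`quad_lower_bound`). A large $N$ absorbs the
error when $\varepsilon<0$, or when $x$ stays away from $1$. -/

namespace RealFragments
open FirstOrder FirstOrder.Language

/-! ### Substitution in natural deduction. -/

section Calculus

variable {L : FirstOrder.Language.{0, 0}} {α : Type}

theorem substTerm_relabel_castSucc {n m : ℕ} (τ : Fin n → L.Term (α ⊕ Fin m))
    (t : L.Term (α ⊕ Fin n)) :
    substTerm (liftSubst τ) (t.relabel (Sum.map id Fin.castSucc)) =
      (substTerm τ t).relabel (Sum.map id Fin.castSucc) := by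
  induction t with
  | var i => rcases i with a | i <;> simp [substTerm, liftSubst, Term.subst, Term.relabel]
  | func f ts ih =>
    simp only [substTerm, Term.subst, Term.relabel] at ih ⊢
    exact congrArg _ (funext ih)

theorem substTerm_snoc_relabel_castSucc {n : ℕ} (s t : L.Term (α ⊕ Fin n)) :
    substTerm (Fin.snoc (α := fun _ => L.Term (α ⊕ Fin n)) (fun i => Term.var (Sum.inr i)) t)
      (s.relabel (Sum.map id Fin.castSucc)) = s := by
  induction s with
  | var i => rcases i with a | i <;> simp [substTerm, Term.subst, Term.relabel]
  | func f ts ih =>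
    simp only [substTerm, Term.subst, Term.relabel] at ih ⊢
    exact congrArg _ (funext ih)

theorem substTerm_liftSubst {n m k : ℕ} (τ : Fin m → L.Term (α ⊕ Fin k))
    (σ : Fin n → L.Term (α ⊕ Fin m)) :
    (fun i => substTerm (liftSubst τ) (liftSubst σ i)) =
      liftSubst (fun i => substTerm τ (σ i)) := by
  funext i
  refine Fin.lastCases ?_ (fun i => ?_) i
  · simp [liftSubst, substTerm, Term.subst]
  · simp only [liftSubst, Fin.snoc_castSucc]
    exact substTerm_relabel_castSucc τ (σ i)

theorem substTerm_substTerm {n m k : ℕ} (τ : Fin m → L.Term (α ⊕ Fin k))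
    (σ : Fin n → L.Term (α ⊕ Fin m)) (t : L.Term (α ⊕ Fin n)) :
    substTerm τ (substTerm σ t) = substTerm (fun i => substTerm τ (σ i)) t := by
  induction t with
  | var i => rcases i with a | i <;> simp [substTerm, Term.subst]
  | func f ts ih =>
    simp only [substTerm, Term.subst] at ih ⊢
    exact congrArg _ (funext ih)

/-- Collapses successive quantifier instantiations into one simultaneous substitution. -/
theorem substFormula_substFormula {n m k : ℕ} (τ : Fin m → L.Term (α ⊕ Fin k))
    (σ : Fin n → L.Term (α ⊕ Fin m)) (φ : L.BoundedFormula α n) :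
    substFormula τ (substFormula σ φ) = substFormula (fun i => substTerm τ (σ i)) φ := by
  induction φ generalizing m k with
  | falsum => rfl
  | equal s t => simp only [substFormula, substTerm_substTerm]
  | rel R ts => simp only [substFormula, substTerm_substTerm]
  | imp φ ψ ih₁ ih₂ => simp only [substFormula, ih₁, ih₂]
  | all φ ih => simp only [substFormula, ih, substTerm_liftSubst]

/-! ### Soundness of the calculus. -/

section Soundness

variable {M : Type} [L.Structure M]

theorem realize_substTerm {n m : ℕ} (σ : Fin n → L.Term (α ⊕ Fin m)) (t : L.Term (α ⊕ Fin n))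
    (v : α → M) (xs : Fin m → M) :
    (substTerm σ t).realize (Sum.elim v xs) =
      t.realize (Sum.elim v fun i => (σ i).realize (Sum.elim v xs)) := by
  rw [substTerm, Term.realize_subst]
  congr 1
  funext i
  rcases i with a | i <;> simp

theorem realize_substFormula {n m : ℕ} (σ : Fin n → L.Term (α ⊕ Fin m))
    (φ : L.BoundedFormula α n) (v : α → M) (xs : Fin m → M) :
    (substFormula σ φ).Realize v xs ↔
      φ.Realize v fun i => (σ i).realize (Sum.elim v xs) := by
  induction φ generalizing m with
  | falsum => rfl
  | equal s t => simp only [substFormula, BoundedFormula.Realize, realize_substTerm]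
  | rel R ts => simp only [substFormula, BoundedFormula.Realize, realize_substTerm]
  | imp φ ψ ih₁ ih₂ => simp only [substFormula, BoundedFormula.Realize, ih₁, ih₂]
  | all φ ih =>
    simp only [substFormula, BoundedFormula.Realize, ih]
    refine forall_congr' fun a => iff_of_eq (congrArg _ (funext fun i => ?_))
    refine Fin.lastCases ?_ (fun i => ?_) i
    · simp [liftSubst]
    · simp only [liftSubst, Fin.snoc_castSucc, Term.realize_relabel]
      congr 1
      funext j
      rcases j with a | j <;> simp

theorem realize_instLast {n : ℕ} (φ : L.BoundedFormula α (n + 1)) (t : L.Term (α ⊕ Fin n))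
    (v : α → M) (xs : Fin n → M) :
    (instLast φ t).Realize v xs ↔ φ.Realize v (Fin.snoc xs (t.realize (Sum.elim v xs))) := by
  rw [instLast, realize_substFormula]
  refine iff_of_eq (congrArg _ (funext fun i => ?_))
  refine Fin.lastCases ?_ (fun i => ?_) i <;> simp

theorem realize_weaken {n : ℕ} (φ : L.BoundedFormula α n) (v : α → M) (xs : Fin n → M) (a : M) :
    (weaken φ).Realize v (Fin.snoc xs a) ↔ φ.Realize v xs := by
  rw [weaken, realize_substFormula]
  simp

/-- Soundness of natural deduction. -/
theorem Derivable.realize {n : ℕ} {Γ : Set (L.BoundedFormula α n)} {φ : L.BoundedFormula α n}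
    (h : Derivable Γ φ) (v : α → M) (xs : Fin n → M) (hΓ : ∀ γ ∈ Γ, γ.Realize v xs) :
    φ.Realize v xs := by
  induction h with
  | hyp h => exact hΓ _ h
  | impIntro _ ih => exact fun h => ih xs (Set.forall_mem_insert.2 ⟨h, hΓ⟩)
  | impElim _ _ ih₁ ih₂ => exact ih₁ xs hΓ (ih₂ xs hΓ)
  | byContradiction _ ih => exact by_contra fun h => ih xs (Set.forall_mem_insert.2 ⟨h, hΓ⟩)
  | allIntro _ ih =>
    intro a
    refine ih _ ?_
    rintro _ ⟨γ, hγ, rfl⟩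
    exact (realize_weaken γ v xs a).2 (hΓ γ hγ)
  | allElim t _ ih => exact (realize_instLast _ t v xs).2 (ih xs hΓ _)
  | eqRefl t => rfl
  | eqSubst φ _ _ ih₁ ih₂ =>
    have e := ih₁ xs hΓ
    simp only [BoundedFormula.Realize] at e
    rw [realize_instLast, ← e, ← realize_instLast]
    exact ih₂ xs hΓ

theorem Proves.realize {T : L.Theory} {φ : L.Sentence} (h : Proves T φ) (hM : M ⊨ T) : M ⊨ φ :=
  Derivable.realize h _ _ fun γ hγ => hM.realize_of_mem γ hγ

end Soundness

/-- Instantiate two leading universal quantifiers of an axiom in a context with one variable. -/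
theorem derivable_substFormula_of_all_all_mem {T : Set (L.BoundedFormula α 0)}
    {θ : L.BoundedFormula α 2} (h : θ.all.all ∈ T) (s t : L.Term (α ⊕ Fin 1)) :
    Derivable (weaken '' T) (substFormula ![s, t] θ) := by
  have h₁ : Derivable (weaken '' T) (weaken θ.all.all) := .hyp ⟨_, h, rfl⟩
  have h₂ := Derivable.allElim t (Derivable.allElim s h₁)
  simp only [instLast, substFormula_substFormula] at h₂
  convert h₂ using 2
  funext i
  refine Fin.lastCases ?_ (fun i => ?_) i
  · simp [liftSubst, substTerm, Term.subst, Fin.snoc, Fin.last]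
  · fin_cases i
    -- The term `s` was lifted under the second quantifier; substituting `t` for that variable
    -- undoes the lift.
    refine (substTerm_snoc_relabel_castSucc s t).symm.trans ?_
    simp [liftSubst, substTerm, Term.subst, Term.relabel, Fin.snoc, Fin.last]

end Calculus

/-! ### An order automorphism of the hyperreals commuting with scaling by `F`. -/

section HaloShift

/-- `x` and the real number `a` differ by an infinitesimal. -/
def Near (x : ℝ*) (a : ℝ) : Prop := ∀ r : ℝ, 0 < r → |x - a| < r

theorem Near.eq {x : ℝ*} {a b : ℝ} (ha : Near x a) (hb : Near x b) : a = b := by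
  by_contra hab
  have hr : 0 < |a - b| / 2 := by have := abs_pos.2 (sub_ne_zero.2 hab); positivity
  have h₁ := ha _ hr
  have h₂ := hb _ hr
  have h₃ : ((|a - b| : ℝ) : ℝ*) = |(a : ℝ*) - b| := by simp
  have h₄ := abs_sub_le (a : ℝ*) x b
  rw [abs_sub_comm (a : ℝ*) x, ← h₃] at h₄
  have h₅ : ((|a - b| / 2 : ℝ) : ℝ*) = ((|a - b| : ℝ) : ℝ*) / 2 := by
    rw [Hyperreal.coe_div]; rfl
  linarith

/-- The factor 3 covers both uses: $|a/y| \le 2$ in `Near.sq_div` and $|x+1| \le 3$ in `Near.sq`. -/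
theorem Near.of_abs_sub_le {x y : ℝ*} {a : ℝ} (hx : Near x a) (h : |y - a| ≤ 3 * |x - a|) :
    Near y a := by
  intro r hr
  have h₁ := hx (r / 3) (by positivity)
  have h₅ : ((r / 3 : ℝ) : ℝ*) = (r : ℝ*) / 3 := by rw [Hyperreal.coe_div]; rfl
  rw [h₅] at h₁
  linarith

theorem Near.const_mul {x : ℝ*} {a : ℝ} (hx : Near x a) {c : ℝ} (hc : c ≠ 0) :
    Near (c * x) (c * a) := by
  intro r hr
  have hc' : 0 < |c| := abs_pos.2 hc
  have h := hx (r / |c|) (div_pos hr hc')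
  rw [Hyperreal.coe_mul, ← mul_sub, abs_mul, ← Hyperreal.coe_abs]
  rw [Hyperreal.coe_div, lt_div_iff₀ (Hyperreal.coe_pos.2 hc')] at h
  rwa [mul_comm]

/-- A number near `a ≠ 0` is at least as far from zero as `a / 2`. -/
theorem Near.abs_le_two_mul_abs {x : ℝ*} {a : ℝ} (hx : Near x a) (ha : a ≠ 0) :
    |(a : ℝ*)| ≤ 2 * |x| := by
  have h := hx (|a| / 2) (half_pos (abs_pos.2 ha))
  have h₅ : ((|a| / 2 : ℝ) : ℝ*) = |(a : ℝ*)| / 2 := by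
    rw [Hyperreal.coe_div, Hyperreal.coe_abs]; rfl
  have h₄ := abs_sub_abs_le_abs_sub (a : ℝ*) x
  rw [abs_sub_comm] at h₄
  linarith

theorem Near.ne_zero {x : ℝ*} {a : ℝ} (hx : Near x a) (ha : a ≠ 0) : x ≠ 0 := by
  rintro rfl
  have := hx.abs_le_two_mul_abs ha
  have h' : (a : ℝ*) ≠ 0 := Hyperreal.coe_ne_zero.2 ha
  rw [abs_zero, mul_zero] at this
  exact h' (abs_nonpos_iff.1 this)

theorem Near.reflect {x : ℝ*} {a : ℝ} (hx : Near x a) : Near (2 * a - x) a := by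
  intro r hr
  have e : 2 * (a : ℝ*) - x - a = -(x - a) := by ring
  rw [e, abs_neg]
  exact hx r hr

/-- A number near `a ≠ 0` has the sign of `a`. -/
theorem Near.mul_pos {x : ℝ*} {a : ℝ} (hx : Near x a) (ha : a ≠ 0) : 0 < a * x := by
  have h := hx (|a|) (abs_pos.2 ha)
  rw [Hyperreal.coe_abs] at h
  have h' : (a : ℝ*) ≠ 0 := Hyperreal.coe_ne_zero.2 ha
  rcases lt_or_gt_of_ne h' with h0 | h0
  · rw [abs_of_neg h0] at h
    have := (abs_lt.1 h).2
    exact mul_pos_of_neg_of_neg h0 (by linarith)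
  · rw [abs_of_pos h0] at h
    have := (abs_lt.1 h).1
    exact _root_.mul_pos h0 (by linarith)

/-- Together with `Near.reflect`, this makes `haloMap` and `haloInv` preserve each halo. -/
theorem Near.sq_div {y : ℝ*} {a : ℝ} (hy : Near y a) (ha : a ≠ 0) : Near (a ^ 2 / y) a := by
  refine hy.of_abs_sub_le ?_
  have hy0 := hy.ne_zero ha
  have e : (a : ℝ*) ^ 2 / y - a = -(a / y) * (y - a) := by field_simp; ring
  rw [e, abs_mul, abs_neg, abs_div]
  refine mul_le_mul_of_nonneg_right ?_ (abs_nonneg _)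
  rw [div_le_iff₀ (abs_pos.2 hy0)]
  have := hy.abs_le_two_mul_abs ha
  have := abs_nonneg y
  linarith

theorem Near.sq {x : ℝ*} (hx : Near x 1) : Near (x ^ 2) 1 := by
  refine hx.of_abs_sub_le ?_
  have h := abs_lt.1 (hx 1 one_pos)
  rw [Hyperreal.coe_one] at h ⊢
  have e : x ^ 2 - 1 = (x + 1) * (x - 1) := by ring
  rw [e, abs_mul]
  refine mul_le_mul_of_nonneg_right (abs_le.2 ⟨?_, ?_⟩) (abs_nonneg _) <;> linarith

/-- Halos are convex, so a point outside one lies on the same side of all its elements. -/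
theorem Near.lt_of_lt {x x' y : ℝ*} {a : ℝ} (hx : Near x a) (hx' : Near x' a) (hy : ¬ Near y a)
    (h : x < y) : x' < y := by
  unfold Near at hy
  push Not at hy
  obtain ⟨r, hr, h₁⟩ := hy
  have h₂ := abs_lt.1 (hx r hr)
  have h₃ := abs_lt.1 (hx' r hr)
  rcases le_abs.1 h₁ with h₄ | h₄ <;> linarith

theorem Near.lt_of_gt {x x' y : ℝ*} {a : ℝ} (hx : Near x a) (hx' : Near x' a) (hy : ¬ Near y a)
    (h : y < x) : y < x' := by
  unfold Near at hy
  push Not at hy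
  obtain ⟨r, hr, h₁⟩ := hy
  have h₂ := abs_lt.1 (hx r hr)
  have h₃ := abs_lt.1 (hx' r hr)
  rcases le_abs.1 h₁ with h₄ | h₄ <;> linarith

variable (F : Subfield ℝ)

open Classical in
/-- Near each nonzero `a ∈ F` the map `x ↦ a² / (2a - x)`, elsewhere the identity. -/
noncomputable def haloMap (x : ℝ*) : ℝ* :=
  if h : ∃ a ∈ F, a ≠ 0 ∧ Near x a then (h.choose : ℝ*) ^ 2 / (2 * h.choose - x) else x

open Classical in
/-- The inverse of `haloMap`. -/
noncomputable def haloInv (y : ℝ*) : ℝ* :=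
  if h : ∃ a ∈ F, a ≠ 0 ∧ Near y a then 2 * (h.choose : ℝ*) - h.choose ^ 2 / y else y

variable {F}

/-- Standard parts are unique, so the choice in the definition does not matter. -/
theorem haloMap_of_near {x : ℝ*} {a : ℝ} (haF : a ∈ F) (ha : a ≠ 0) (hx : Near x a) :
    haloMap F x = (a : ℝ*) ^ 2 / (2 * a - x) := by
  have h : ∃ a ∈ F, a ≠ 0 ∧ Near x a := ⟨a, haF, ha, hx⟩
  rw [haloMap, dif_pos h, h.choose_spec.2.2.eq hx]

theorem haloMap_of_not_near {x : ℝ*} (h : ¬ ∃ a ∈ F, a ≠ 0 ∧ Near x a) : haloMap F x = x :=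
  dif_neg h

theorem haloInv_of_near {x : ℝ*} {a : ℝ} (haF : a ∈ F) (ha : a ≠ 0) (hx : Near x a) :
    haloInv F x = 2 * (a : ℝ*) - a ^ 2 / x := by
  have h : ∃ a ∈ F, a ≠ 0 ∧ Near x a := ⟨a, haF, ha, hx⟩
  rw [haloInv, dif_pos h, h.choose_spec.2.2.eq hx]

theorem haloInv_of_not_near {x : ℝ*} (h : ¬ ∃ a ∈ F, a ≠ 0 ∧ Near x a) : haloInv F x = x :=
  dif_neg h

theorem haloInv_haloMap (x : ℝ*) : haloInv F (haloMap F x) = x := by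
  by_cases h : ∃ a ∈ F, a ≠ 0 ∧ Near x a
  · obtain ⟨a, haF, ha, hx⟩ := h
    rw [haloMap_of_near haF ha hx, haloInv_of_near haF ha (hx.reflect.sq_div ha)]
    have h₁ := hx.reflect.ne_zero ha
    have h₂ : (a : ℝ*) ≠ 0 := Hyperreal.coe_ne_zero.2 ha
    field_simp
    ring
  · rw [haloMap_of_not_near h, haloInv_of_not_near h]

theorem haloMap_haloInv (y : ℝ*) : haloMap F (haloInv F y) = y := by
  by_cases h : ∃ a ∈ F, a ≠ 0 ∧ Near y a
  · obtain ⟨a, haF, ha, hy⟩ := h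
    rw [haloInv_of_near haF ha hy, haloMap_of_near haF ha (hy.sq_div ha).reflect]
    have h₁ := hy.ne_zero ha
    have h₂ : (a : ℝ*) ≠ 0 := Hyperreal.coe_ne_zero.2 ha
    rw [sub_sub_cancel]
    field_simp
  · rw [haloInv_of_not_near h, haloMap_of_not_near h]

/-- Each shifted halo is mapped to itself and is convex, so only two points of the same halo need a
computation. -/
theorem haloMap_strictMono : StrictMono (haloMap F) := by
  intro x y hxy
  by_cases hx : ∃ a ∈ F, a ≠ 0 ∧ Near x a
  · obtain ⟨a, haF, ha, hx⟩ := hx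
    have hx' := hx.reflect.sq_div ha
    rw [haloMap_of_near haF ha hx]
    by_cases hya : Near y a
    · rw [haloMap_of_near haF ha hya]
      have h₁ := hx.reflect.mul_pos ha
      have h₂ := hya.reflect.mul_pos ha
      have h₃ := hx.reflect.ne_zero ha
      have h₄ := hya.reflect.ne_zero ha
      have h₅ : (a : ℝ*) ≠ 0 := Hyperreal.coe_ne_zero.2 ha
      rw [← sub_pos]
      -- Both denominators are multiplied by $a$, which makes them positive whatever the sign of
      -- $a$.
      have e : (a : ℝ*) ^ 2 / (2 * a - y) - a ^ 2 / (2 * a - x) =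
          a ^ 4 * (y - x) / ((a * (2 * a - x)) * (a * (2 * a - y))) := by
        rw [div_sub_div _ _ h₄ h₃, div_eq_div_iff (mul_ne_zero h₄ h₃)
          (mul_ne_zero (mul_ne_zero h₅ h₃) (mul_ne_zero h₅ h₄))]
        ring
      rw [e]
      have := sub_pos.2 hxy
      positivity
    · have h₁ := hx.lt_of_lt hx' hya hxy
      by_cases hy : ∃ b ∈ F, b ≠ 0 ∧ Near y b
      · obtain ⟨b, hbF, hb, hy⟩ := hy
        rw [haloMap_of_near hbF hb hy]
        refine hy.lt_of_gt (hy.reflect.sq_div hb) (fun h => hya ?_) h₁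
        rwa [hx'.eq h]
      · rwa [haloMap_of_not_near hy]
  · rw [haloMap_of_not_near hx]
    by_cases hy : ∃ b ∈ F, b ≠ 0 ∧ Near y b
    · obtain ⟨b, hbF, hb, hy⟩ := hy
      rw [haloMap_of_near hbF hb hy]
      exact hy.lt_of_gt (hy.reflect.sq_div hb) (fun h => hx ⟨b, hbF, hb, h⟩) hxy
    · rwa [haloMap_of_not_near hy]

variable (F) in
/-- `haloMap` as an automorphism of the ordered set of hyperreals. -/
noncomputable def haloEquiv : ℝ* ≃ ℝ* where
  toFun := haloMap F
  invFun := haloInv F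
  left_inv := haloInv_haloMap
  right_inv := haloMap_haloInv

theorem near_zero_zero : Near 0 0 := by
  intro r hr
  simpa using hr

theorem near_one_one : Near 1 1 := by
  intro r hr
  simpa using hr

theorem haloMap_zero : haloMap F 0 = 0 := by
  refine haloMap_of_not_near ?_
  rintro ⟨a, -, ha, h⟩
  exact ha (h.eq near_zero_zero)

theorem haloMap_one : haloMap F 1 = 1 := by
  rw [haloMap_of_near F.one_mem one_ne_zero near_one_one]
  norm_num

/-- A nonzero $c \in F$ permutes the halos of nonzero elements of `F`, and $a^2/(2a-x)$ is
homogeneous of degree 1 in $(a,x)$. Shifting the halo of $1$ alone would not commute with the $f_c$.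
-/
theorem haloMap_coe_mul {c : ℝ} (hc : c ∈ F) (x : ℝ*) :
    haloMap F (c * x) = c * haloMap F x := by
  rcases eq_or_ne c 0 with rfl | hc0
  · simp [haloMap_zero]
  have hc' : (c : ℝ*) ≠ 0 := Hyperreal.coe_ne_zero.2 hc0
  by_cases h : ∃ a ∈ F, a ≠ 0 ∧ Near x a
  · obtain ⟨a, haF, ha, hx⟩ := h
    rw [haloMap_of_near haF ha hx,
      haloMap_of_near (F.mul_mem hc haF) (mul_ne_zero hc0 ha) (hx.const_mul hc0)]
    have h₁ := hx.reflect.ne_zero ha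
    rw [Hyperreal.coe_mul]
    have e : 2 * ((c : ℝ*) * a) - c * x = c * (2 * a - x) := by ring
    rw [e]
    field_simp
  · rw [haloMap_of_not_near h, haloMap_of_not_near]
    rintro ⟨a, haF, ha, hx⟩
    refine h ⟨c⁻¹ * a, F.mul_mem (F.inv_mem hc) haF, mul_ne_zero (inv_ne_zero hc0) ha, ?_⟩
    have := hx.const_mul (inv_ne_zero hc0)
    rwa [Hyperreal.coe_inv, inv_mul_cancel_left₀ hc'] at this

/-- The square of a number near `1` for the multiplication transported along `haloMap`. -/
theorem haloInv_mul_haloMap {x : ℝ*} (hx : Near x 1) :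
    haloInv F (haloMap F x * haloMap F x) = 2 - (2 - x) ^ 2 := by
  have h₁ := hx.reflect
  have h₂ := h₁.ne_zero one_ne_zero
  have h₃ : haloMap F x * haloMap F x = ((2 * (1 : ℝ) - x) ^ 2)⁻¹ := by
    rw [haloMap_of_near F.one_mem one_ne_zero hx]
    field_simp
    norm_num
  have h₄ : Near ((2 * (1 : ℝ) - x) ^ 2)⁻¹ 1 := by
    simpa using h₁.sq.sq_div one_ne_zero
  rw [h₃, haloInv_of_near F.one_mem one_ne_zero h₄]
  simp

end HaloShift

/-! ### The model of `T[F]` and the unprovability results. -/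

section TwistedModel

open Filter

/-- The hyperreals as an ultrapower of the structure of the reals. -/
noncomputable instance hyperrealStructure {L : FirstOrder.Language.{0, 0}} [L.Structure ℝ] :
    L.Structure ℝ* :=
  inferInstanceAs (L.Structure ((hyperfilter ℕ : Filter ℕ).Product fun _ => ℝ))

/-- Łoś's theorem. -/
theorem hyperreal_model_completeTheory (L : FirstOrder.Language.{0, 0}) [L.Structure ℝ] :
    ℝ* ⊨ L.completeTheory ℝ := by
  refine ⟨fun φ hφ => ?_⟩
  exact (Ultraproduct.sentence_realize (M := fun _ : ℕ => ℝ) (u := hyperfilter ℕ) φ).2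
    (Eventually.of_forall fun _ => hφ)

theorem hyperreal_funMap_ofSeq {L : FirstOrder.Language.{0, 0}} [L.Structure ℝ] {n : ℕ}
    (f : L.Functions n) (x : Fin n → ℕ → ℝ) :
    Structure.funMap f (fun i => Hyperreal.ofSeq (x i)) =
      Hyperreal.ofSeq fun a => Structure.funMap f fun i => x i a :=
  Ultraproduct.funMap_cast (M := fun _ : ℕ => ℝ) (u := hyperfilter ℕ) f x

theorem hyperreal_relMap_ofSeq {L : FirstOrder.Language.{0, 0}} [L.Structure ℝ] {n : ℕ}
    (R : L.Relations n) (x : Fin n → ℕ → ℝ) :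
    Structure.RelMap R (fun i => Hyperreal.ofSeq (x i)) ↔
      ∀ᶠ a in hyperfilter ℕ, Structure.RelMap R fun i => x i a :=
  relMap_quotient_mk' (s := (hyperfilter ℕ : Filter ℕ).productSetoid fun _ => ℝ) (r := R) x

/-- Representing sequences let the operations and relations of the ultrapower be computed
coordinatewise. -/
theorem exists_eq_ofSeq {n : ℕ} (v : Fin n → ℝ*) :
    ∃ x : Fin n → ℕ → ℝ, v = fun i => Hyperreal.ofSeq (x i) := by
  choose x hx using fun i => Hyperreal.ofSeq_surjective (v i)
  exact ⟨x, funext fun i => (hx i).symm⟩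

variable (F : Subfield ℝ)

/-- The hyperreals with the usual addition and with the multiplication transported along
`haloMap`. -/
def Twisted (_ : Subfield ℝ) : Type := ℝ*

noncomputable instance twistedStructure : (fullLang F).Structure (Twisted F) where
  funMap := fun {n} (f : FullFunc F n) =>
    match n, f with
    | _, .zero => fun _ => (0 : ℝ*)
    | _, .one => fun _ => (1 : ℝ*)
    | _, .scale a => fun v : Fin 1 → ℝ* => ((a : ℝ) : ℝ*) * v 0
    | _, .add => fun v : Fin 2 → ℝ* => v 0 + v 1
    | _, .sub => fun v : Fin 2 → ℝ* => v 0 - v 1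
    | _, .mul => fun v : Fin 2 → ℝ* => haloInv F (haloMap F (v 0) * haloMap F (v 1))
    | _, .div => fun v : Fin 2 → ℝ* => haloInv F (haloMap F (v 0) / haloMap F (v 1))
  RelMap := fun {n} (R : OrdRel n) =>
    match n, R with
    | _, .lt => fun v : Fin 2 → ℝ* => v 0 < v 1

noncomputable instance twistedAddStructure : (addLang F).Structure (Twisted F) := (addHom F).reduct (Twisted F)

noncomputable instance twistedMultStructure : (multLang F).Structure (Twisted F) :=
  (multHom F).reduct (Twisted F)

/-- The additive reduct of the twisted model is the ultrapower. -/
noncomputable def twistedAddEquiv : ℝ* ≃[addLang F] Twisted F where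
  toEquiv := Equiv.refl ℝ*
  map_fun' f v := by
    obtain ⟨x, rfl⟩ := exists_eq_ofSeq v
    rw [hyperreal_funMap_ofSeq]
    cases f <;> rfl
  map_rel' R v := by
    obtain ⟨x, rfl⟩ := exists_eq_ofSeq v
    rw [hyperreal_relMap_ofSeq]
    cases R
    exact Hyperreal.ofSeq_lt_ofSeq

/-- The multiplicative reduct of the twisted model is isomorphic to the ultrapower. -/
noncomputable def twistedMultEquiv : Twisted F ≃[multLang F] ℝ* where
  toEquiv := haloEquiv F
  map_fun' {n} f v := by
    obtain ⟨x, hx⟩ := exists_eq_ofSeq (fun i => haloMap F (v i))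
    change haloMap F (Structure.funMap (M := Twisted F) f v) = Structure.funMap f fun i => haloMap F (v i)
    rw [hx, hyperreal_funMap_ofSeq]
    cases f with
    | zero => exact haloMap_zero
    | one => exact haloMap_one
    | scale a => exact (haloMap_coe_mul a.2 _).trans (congrArg _ (congrFun hx 0))
    | mul => exact (haloMap_haloInv _).trans (congrArg₂ (· * ·) (congrFun hx 0) (congrFun hx 1))
    | div => exact (haloMap_haloInv _).trans (congrArg₂ (· / ·) (congrFun hx 0) (congrFun hx 1))
  map_rel' {n} R v := by
    obtain ⟨x, hx⟩ := exists_eq_ofSeq (fun i => haloMap F (v i))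
    change (Structure.RelMap R fun i => haloMap F (v i)) ↔
      Structure.RelMap (M := Twisted F) R v
    rw [hx, hyperreal_relMap_ofSeq]
    cases R
    refine Hyperreal.ofSeq_lt_ofSeq.symm.trans ?_
    rw [← congrFun hx 0, ← congrFun hx 1]
    exact haloMap_strictMono.lt_iff_lt

/-- Each theory is verified in its own reduct. The two isomorphisms with the ultrapower are
different maps, which leaves sentences mixing $+$ and $\times$ free to fail. -/
theorem twisted_model : Twisted F ⊨ theoryT F := by
  have : ℝ* ⊨ theoryAdd F := hyperreal_model_completeTheory (addLang F)
  have : ℝ* ⊨ theoryMult F := hyperreal_model_completeTheory (multLang F)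
  refine Theory.Model.union ?_ ?_
  · exact ((addHom F).onTheory_model _).2 (StrongHomClass.theory_model (twistedAddEquiv F))
  · exact ((multHom F).onTheory_model _).2 (StrongHomClass.theory_model (twistedMultEquiv F).symm)

variable {F}

theorem realize_leF {n : ℕ} (s t : (fullLang F).Term (Empty ⊕ Fin n)) (v : Empty → Twisted F)
    (xs : Fin n → Twisted F) :
    (leF s t).Realize v xs ↔
      LE.le (α := ℝ*) (s.realize (M := Twisted F) (Sum.elim v xs))
        (t.realize (M := Twisted F) (Sum.elim v xs)) := by
  rw [leF, BoundedFormula.realize_sup]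
  exact (le_iff_lt_or_eq (α := ℝ*)).symm

theorem realize_constT (a : F) {β : Type} (v : β → Twisted F) :
    (constT a).realize v = ((a : ℝ) : ℝ*) :=
  mul_one ((a : ℝ) : ℝ*)

/-- $2-(2-x)^2-2x+1 = -(x-1)^2$: the transported parabola touches the line $2x-1$ at $1$ from below.
-/
theorem realize_quadT (v : Empty → Twisted F) (xs : Fin 1 → ℝ*) (hx : Near (xs 0) 1) :
    Eq (α := ℝ*) ((quadT (F := F)).realize (M := Twisted F) (Sum.elim v xs)) (-(xs 0 - 1) ^ 2) := by
  change haloInv F (haloMap F (xs 0) * haloMap F (xs 0)) - (((2 : F) : ℝ) : ℝ*) * xs 0 + 1 = _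
  have h₂ : (((2 : F) : ℝ) : ℝ*) = 2 := rfl
  rw [haloInv_mul_haloMap hx, h₂]
  ring

variable (F) in
/-- In the twisted model `x² - 2x + 1` is negative at points infinitely close to `1`. -/
theorem twisted_quadT_neg (v : Empty → Twisted F) {x : ℝ*} (hx : Near x 1) (hx1 : x ≠ 1) :
    LT.lt (α := ℝ*) ((quadT (F := F)).realize (M := Twisted F)
      (Sum.elim v (Fin.snoc (α := fun _ => Twisted F) default x))) 0 := by
  have h := realize_quadT v (Fin.snoc (α := fun _ => ℝ*) default x) hx
  refine lt_of_eq_of_lt h (neg_lt_zero.2 ?_)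
  have := sub_ne_zero.2 hx1
  change 0 < (x - 1) ^ 2
  positivity

theorem near_one_add_epsilon : Near (1 + Hyperreal.epsilon) 1 := by
  intro r hr
  rw [Hyperreal.coe_one, add_sub_cancel_left, abs_of_pos Hyperreal.epsilon_pos]
  exact Hyperreal.epsilon_lt_of_pos hr

theorem near_one_sub_epsilon : Near (1 - Hyperreal.epsilon) 1 := by
  intro r hr
  rw [Hyperreal.coe_one, sub_sub_cancel_left, abs_neg, abs_of_pos Hyperreal.epsilon_pos]
  exact Hyperreal.epsilon_lt_of_pos hr

theorem one_add_epsilon_ne_one : 1 + Hyperreal.epsilon ≠ 1 := by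
  simp

theorem one_sub_epsilon_ne_one : 1 - Hyperreal.epsilon ≠ 1 := by
  simp

theorem lt_zero_of_proves_quadGe {ε : F} (h : Proves (theoryT F) (quadGe ε)) : (ε : ℝ) < 0 := by
  have h₁ := (realize_leF _ _ _ _).1 (h.realize (twisted_model F) (1 + Hyperreal.epsilon : ℝ*))
  have h₂ := lt_of_le_of_lt h₁ (twisted_quadT_neg F _ near_one_add_epsilon one_add_epsilon_ne_one)
  rw [realize_constT, ← Hyperreal.coe_zero] at h₂
  exact Hyperreal.coe_lt_coe.1 h₂

theorem not_proves_quadNonneg : ¬ Proves (theoryT F) (quadNonneg F) := by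
  intro h
  have h₁ := (realize_leF _ _ _ _).1 (h.realize (twisted_model F) (1 + Hyperreal.epsilon : ℝ*))
  have h₂ := lt_of_le_of_lt h₁ (twisted_quadT_neg F _ near_one_add_epsilon one_add_epsilon_ne_one)
  exact lt_irrefl (0 : ℝ*) h₂

theorem lt_one_of_proves_quadNonnegBelow {r : F}
    (h : Proves (theoryT F) (quadNonnegBelow r)) : (r : ℝ) < 1 := by
  by_contra hr
  -- The witness is taken to the left of $1$ so that the premise $x \le r$ holds even for $r = 1$.
  have h₀ : (1 - Hyperreal.epsilon : ℝ*) ≤ (r : ℝ) := by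
    have h₃ : ((1 : ℝ) : ℝ*) ≤ (r : ℝ) := Hyperreal.coe_le_coe.2 (not_lt.1 hr)
    rw [Hyperreal.coe_one] at h₃
    linarith [Hyperreal.epsilon_pos]
  have h₁ := (realize_leF _ _ _ _).1 (h.realize (twisted_model F) (1 - Hyperreal.epsilon : ℝ*)
    ((realize_leF _ _ _ _).2 (by rw [realize_constT]; exact h₀)))
  have h₂ := lt_of_le_of_lt h₁ (twisted_quadT_neg F _ near_one_sub_epsilon one_sub_epsilon_ne_one)
  exact lt_irrefl (0 : ℝ*) h₂

theorem one_lt_of_proves_quadNonnegAbove {r : F}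
    (h : Proves (theoryT F) (quadNonnegAbove r)) : 1 < (r : ℝ) := by
  by_contra hr
  have h₀ : ((r : ℝ) : ℝ*) ≤ 1 + Hyperreal.epsilon := by
    have h₃ : ((r : ℝ) : ℝ*) ≤ (1 : ℝ) := Hyperreal.coe_le_coe.2 (not_lt.1 hr)
    rw [Hyperreal.coe_one] at h₃
    linarith [Hyperreal.epsilon_pos]
  have h₁ := (realize_leF _ _ _ _).1 (h.realize (twisted_model F) (1 + Hyperreal.epsilon : ℝ*)
    ((realize_leF _ _ _ _).2 (by rw [realize_constT]; exact h₀)))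
  have h₂ := lt_of_le_of_lt h₁ (twisted_quadT_neg F _ near_one_add_epsilon one_add_epsilon_ne_one)
  exact lt_irrefl (0 : ℝ*) h₂

end TwistedModel

/-! ### Interpolants and the provability results. -/

section Interpolation

/-- Function symbols `1, f_a (a ∈ F)`. -/
inductive ScaleFunc (F : Subfield ℝ) : ℕ → Type
  | one : ScaleFunc F 0
  | scale (a : F) : ScaleFunc F 1

/-- The language `1, <, f_a`, common to the additive and the multiplicative language. -/
def scaleLang (F : Subfield ℝ) : FirstOrder.Language.{0, 0} := ⟨ScaleFunc F, OrdRel⟩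

/-- The inclusion in the additive language. -/
def scaleHomAdd (F : Subfield ℝ) : scaleLang F →ᴸ addLang F where
  onFunction := fun {n} (f : ScaleFunc F n) =>
    match n, f with
    | _, .one => AddFunc.one
    | _, .scale a => AddFunc.scale a
  onRelation := fun {_} (R : OrdRel _) => R

/-- The inclusion in the multiplicative language. -/
def scaleHomMult (F : Subfield ℝ) : scaleLang F →ᴸ multLang F where
  onFunction := fun {n} (f : ScaleFunc F n) =>
    match n, f with
    | _, .one => MultFunc.one
    | _, .scale a => MultFunc.scale a
  onRelation := fun {_} (R : OrdRel _) => R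

variable {F : Subfield ℝ}

theorem addHom_comp_scaleHomAdd :
    (addHom F).comp (scaleHomAdd F) = (multHom F).comp (scaleHomMult F) := by
  refine LHom.funext ?_ rfl
  funext n f
  cases f <;> rfl

noncomputable instance scaleStructure (F : Subfield ℝ) : (scaleLang F).Structure ℝ :=
  (scaleHomAdd F).reduct ℝ

/-- The common structure is defined as an additive reduct; it is equally the multiplicative one, so
the interpolant has the same meaning on both sides. -/
instance : (scaleHomMult F).IsExpansionOn ℝ where
  map_onFunction f v := by cases f <;> rfl
  map_onRelation R v := by cases R; rfl

theorem realize_all_all {L : FirstOrder.Language.{0, 0}} [L.Structure ℝ]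
    (θ : L.BoundedFormula Empty 2) :
    ℝ ⊨ (θ.all.all : L.Sentence) ↔ ∀ x y : ℝ, θ.Realize default ![x, y] := by
  refine forall₂_congr fun x y => ?_
  have h : (Fin.snoc (Fin.snoc default x) y : Fin 2 → ℝ) = ![x, y] := by
    funext i
    fin_cases i <;> rfl
  rw [← h]
  exact iff_of_eq (congrArg (θ.Realize · _) (Subsingleton.elim _ _))

/-- The first of two variables. -/
def var₀ {L : FirstOrder.Language.{0, 0}} : L.Term (Empty ⊕ Fin 2) := Term.var (Sum.inr 0)

/-- The second of two variables. -/
def var₁ {L : FirstOrder.Language.{0, 0}} : L.Term (Empty ⊕ Fin 2) := Term.var (Sum.inr 1)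

/-- The formula `y = x × x` of the multiplicative language. -/
def sqFormula : (multLang F).BoundedFormula Empty 2 :=
  .equal var₁ (Term.func (MultFunc.mul : (multLang F).Functions 2) ![var₀, var₀])

/-- If `φ(x, y)` in the common language holds in the reals for `y = x × x` and implies `ψ(x, y)`,
then `T[F]` proves `∀ x ψ(x, x × x)`. -/
theorem proves_of_interpolant (φ : (scaleLang F).BoundedFormula Empty 2)
    (ψ : (addLang F).BoundedFormula Empty 2)
    (hmult : ∀ x : ℝ, φ.Realize default ![x, x * x])
    (hadd : ∀ x y : ℝ, φ.Realize default ![x, y] → ψ.Realize default ![x, y]) :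
    Proves (theoryT F)
      (substFormula ![varX, mulT varX varX] ((addHom F).onBoundedFormula ψ)).all := by
  have ha : ((addHom F).onBoundedFormula
      (((scaleHomAdd F).onBoundedFormula φ).imp ψ)).all.all ∈ theoryT F := by
    refine Or.inl ⟨(((scaleHomAdd F).onBoundedFormula φ).imp ψ).all.all, ?_, rfl⟩
    refine (realize_all_all _).2 fun x y => ?_
    rw [BoundedFormula.realize_imp, LHom.realize_onBoundedFormula]
    exact hadd x y
  -- The premise $y = x \times x$ becomes a reflexivity when $x \times x$ is substituted for $y$.
  have hm : ((multHom F).onBoundedFormula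
      (sqFormula.imp
          ((scaleHomMult F).onBoundedFormula φ))).all.all ∈ theoryT F := by
    refine Or.inr ⟨(sqFormula.imp
          ((scaleHomMult F).onBoundedFormula φ)).all.all, ?_, rfl⟩
    refine (realize_all_all _).2 fun x y => ?_
    rw [BoundedFormula.realize_imp, LHom.realize_onBoundedFormula]
    intro h
    have h' : y = x * x := h
    rw [h']
    exact hmult x
  have ha' := derivable_substFormula_of_all_all_mem ha varX (mulT varX varX)
  have hm' := derivable_substFormula_of_all_all_mem hm varX (mulT varX varX)
  have e : substFormula ![varX, mulT varX varX] ((multHom F).onBoundedFormula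
      sqFormula) =
      .equal (mulT varX varX) (mulT varX varX) := by
    refine congrArg₂ BoundedFormula.equal rfl (congrArg (Term.func _) (funext fun i => ?_))
    fin_cases i <;> rfl
  refine .allIntro (.impElim ha' ?_)
  -- The two translations of `φ` into the full language coincide, so the conclusion of one axiom is
  -- the premise of the other.
  have hc := congrFun (congrArg (LHom.onBoundedFormula (α := Empty) (k := 2))
    (addHom_comp_scaleHomAdd (F := F))) φ
  rw [LHom.comp_onBoundedFormula, LHom.comp_onBoundedFormula] at hc
  simp only [Function.comp_apply] at hc
  change Derivable _ (substFormula _ ((addHom F).onBoundedFormula _))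
  rw [hc]
  refine .impElim hm' ?_
  change Derivable _ (substFormula ![varX, mulT varX varX] ((multHom F).onBoundedFormula
      sqFormula))
  rw [e]
  exact .eqRefl _

/-- `s ≤ t` in a language with the relation symbol `lt`. -/
def leOf {L : FirstOrder.Language.{0, 0}} {n : ℕ} (lt : L.Relations 2)
    (s t : L.Term (Empty ⊕ Fin n)) : L.BoundedFormula Empty n :=
  BoundedFormula.rel lt ![s, t] ⊔ BoundedFormula.equal s t

/-- `f_a(t)` in the common language. -/
def scaleOf (a : F) {β : Type} (t : (scaleLang F).Term β) : (scaleLang F).Term β :=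
  Term.func (ScaleFunc.scale a : (scaleLang F).Functions 1) ![t]

theorem realize_leOf_scaleLang {n : ℕ} (s t : (scaleLang F).Term (Empty ⊕ Fin n))
    (v : Empty → ℝ) (xs : Fin n → ℝ) :
    (leOf (OrdRel.lt : (scaleLang F).Relations 2) s t).Realize v xs ↔
      s.realize (Sum.elim v xs) ≤ t.realize (Sum.elim v xs) := by
  exact BoundedFormula.realize_sup.trans le_iff_lt_or_eq.symm

theorem realize_leOf_addLang {n : ℕ} (s t : (addLang F).Term (Empty ⊕ Fin n))
    (v : Empty → ℝ) (xs : Fin n → ℝ) :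
    (leOf (OrdRel.lt : (addLang F).Relations 2) s t).Realize v xs ↔
      s.realize (Sum.elim v xs) ≤ t.realize (Sum.elim v xs) := by
  exact BoundedFormula.realize_sup.trans le_iff_lt_or_eq.symm

variable (F) in
/-- `0 ≤ y`, and `c ≤ x → c x ≤ y` for all `c = i / N` with `0 ≤ i ≤ 2N`. -/
noncomputable def gridFormula (N : ℕ) : (scaleLang F).BoundedFormula Empty 2 :=
  leOf OrdRel.lt (scaleOf 0 var₀) var₁ ⊓
    BoundedFormula.iInf fun i : Fin (2 * N + 1) =>
      (leOf OrdRel.lt (scaleOf ((i : F) / (N : F))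
        (Constants.term (L := scaleLang F) ScaleFunc.one)) var₀).imp
        (leOf OrdRel.lt (scaleOf ((i : F) / (N : F)) var₀) var₁)

theorem realize_gridFormula {N : ℕ} (x y : ℝ) :
    (gridFormula F N).Realize default ![x, y] ↔
      0 ≤ y ∧ ∀ i : ℕ, i ≤ 2 * N → (i : ℝ) / N ≤ x → (i : ℝ) / N * x ≤ y := by
  -- The common language has no symbol for zero; $f_0(x)$ stands in for it.
  have h₀ : (leOf (OrdRel.lt : (scaleLang F).Relations 2) (scaleOf (0 : F) var₀) var₁).Realize
      default ![x, y] ↔ 0 ≤ y := by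
    refine (realize_leOf_scaleLang _ _ _ _).trans ?_
    change ((0 : F) : ℝ) * x ≤ y ↔ _
    rw [F.coe_zero, zero_mul]
  rw [gridFormula, BoundedFormula.realize_inf, h₀, BoundedFormula.realize_iInf]
  refine and_congr_right' ?_
  have h₁ : ∀ i : ℕ, (((i : F) / (N : F) : F) : ℝ) = (i : ℝ) / N := fun i => by push_cast; rfl
  have h₂ : ∀ i : Fin (2 * N + 1), ((leOf (OrdRel.lt : (scaleLang F).Relations 2)
      (scaleOf ((i : F) / (N : F)) (Constants.term (L := scaleLang F) ScaleFunc.one)) var₀).imp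
        (leOf OrdRel.lt (scaleOf ((i : F) / (N : F)) var₀) var₁)).Realize default ![x, y] ↔
      (((i : ℕ) : ℝ) / N ≤ x → ((i : ℕ) : ℝ) / N * x ≤ y) := by
    intro i
    refine BoundedFormula.realize_imp.trans ?_
    rw [realize_leOf_scaleLang, realize_leOf_scaleLang, ← h₁]
    change ((((i : F) / (N : F) : F) : ℝ) * 1 ≤ x → _) ↔ _
    rw [mul_one]
    rfl
  refine ⟨fun h i hi => ?_, fun h i => (h₂ i).2 (h i (Nat.lt_succ_iff.1 i.2))⟩
  exact (h₂ ⟨i, Nat.lt_succ_iff.2 hi⟩).1 (h _)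

theorem realize_gridFormula_sq {N : ℕ} (x : ℝ) :
    (gridFormula F N).Realize default ![x, x * x] := by
  refine (realize_gridFormula x _).2 ⟨mul_self_nonneg x, fun i _ h => ?_⟩
  have : (0 : ℝ) ≤ (i : ℝ) / N := by positivity
  exact mul_le_mul_of_nonneg_right h (this.trans h)

/-- For $x<0$ use $y \ge 0$; for $x \ge 2$ the grid point $2$ gives $y \ge 2x$. In between take $c =
\lfloor xN\rfloor/N \ge x - 1/N$, so that $y \ge cx \ge x^2 - x/N \ge x^2 - 2/N$. -/
theorem quad_lower_bound {N : ℕ} (hN : 0 < N) {x y : ℝ}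
    (h : (gridFormula F N).Realize default ![x, y]) :
    1 ≤ y - 2 * x + 1 ∨ (x - 1) ^ 2 - 2 / N ≤ y - 2 * x + 1 := by
  obtain ⟨hy, hg⟩ := (realize_gridFormula x y).1 h
  have hN' : (0 : ℝ) < N := Nat.cast_pos.2 hN
  rcases lt_or_ge x 0 with hx | hx
  · left
    linarith
  rcases lt_or_ge x 2 with hx2 | hx2
  · right
    have h₁ : ((⌊x * N⌋₊ : ℕ) : ℝ) ≤ x * N := Nat.floor_le (by positivity)
    have h₂ : x * N < (⌊x * N⌋₊ : ℕ) + 1 := Nat.lt_floor_add_one _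
    have h₃ : ⌊x * N⌋₊ ≤ 2 * N := by
      have : ((⌊x * N⌋₊ : ℕ) : ℝ) ≤ (2 * N : ℕ) := by
        push_cast
        exact h₁.trans (mul_le_mul_of_nonneg_right hx2.le hN'.le)
      exact_mod_cast this
    have h₄ := hg _ h₃ ((div_le_iff₀ hN').2 h₁)
    have h₅ : x - 1 / N ≤ ((⌊x * N⌋₊ : ℕ) : ℝ) / N := by
      rw [le_div_iff₀ hN', sub_mul, one_div, inv_mul_cancel₀ hN'.ne']
      linarith
    have h₆ := mul_le_mul_of_nonneg_right h₅ hx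
    have h₇ : 1 / (N : ℝ) * x ≤ 2 / N := by
      rw [one_div_mul_eq_div]
      exact div_le_div_of_nonneg_right hx2.le hN'.le
    nlinarith
  · left
    have h₁ : ((2 * N : ℕ) : ℝ) / N = 2 := by
      push_cast
      field_simp
    have h₂ := hg (2 * N) le_rfl (by rw [h₁]; exact hx2)
    rw [h₁] at h₂
    linarith

theorem exists_two_div_le {δ : ℝ} (hδ : 0 < δ) : ∃ N : ℕ, 0 < N ∧ 2 / (N : ℝ) ≤ δ := by
  obtain ⟨N, hN⟩ := exists_nat_gt (2 / δ)
  have h : (0 : ℝ) < N := (by positivity : 0 < 2 / δ).trans hN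
  refine ⟨N, Nat.cast_pos.1 h, ?_⟩
  rw [div_lt_iff₀ hδ] at hN
  rw [div_le_iff₀ h]
  linarith

/-! ### Additive formulas and their images in the full language. -/

/-- The additive term `f_a(1)`. -/
def constOf (a : F) {β : Type} : (addLang F).Term β :=
  Term.func (AddFunc.scale a : (addLang F).Functions 1)
    ![Term.func (AddFunc.one : (addLang F).Functions 0) ![] ]

/-- The additive term `0`. -/
def zeroOf {β : Type} : (addLang F).Term β :=
  Term.func (AddFunc.zero : (addLang F).Functions 0) ![]

/-- The additive term `y - 2x + 1`. -/
noncomputable def linearTerm : (addLang F).Term (Empty ⊕ Fin 2) :=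
  Term.func (AddFunc.add : (addLang F).Functions 2)
    ![Term.func (AddFunc.sub : (addLang F).Functions 2)
        ![var₁, Term.func (AddFunc.scale 2 : (addLang F).Functions 1) ![var₀] ],
      Term.func (AddFunc.one : (addLang F).Functions 0) ![] ]

theorem realize_constOf (a : F) {β : Type} (v : β → ℝ) : (constOf a).realize v = (a : ℝ) :=
  mul_one (a : ℝ)

theorem realize_linearTerm (x y : ℝ) :
    (linearTerm (F := F)).realize (Sum.elim default ![x, y]) = y - 2 * x + 1 := by
  change y - ((2 : F) : ℝ) * x + 1 = _
  have h : ((2 : F) : ℝ) = 2 := rfl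
  rw [h]

theorem substTerm_func₁ (f : AddFunc F 1) {n m : ℕ}
    (σ : Fin n → (fullLang F).Term (Empty ⊕ Fin m)) (s : (addLang F).Term (Empty ⊕ Fin n)) :
    substTerm σ ((addHom F).onTerm (Term.func (f : (addLang F).Functions 1) ![s])) =
      Term.func ((addHom F).onFunction f) ![substTerm σ ((addHom F).onTerm s)] := by
  refine congrArg (Term.func _) (funext fun i => ?_)
  fin_cases i
  rfl

theorem substTerm_func₂ (f : AddFunc F 2) {n m : ℕ}
    (σ : Fin n → (fullLang F).Term (Empty ⊕ Fin m)) (s t : (addLang F).Term (Empty ⊕ Fin n)) :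
    substTerm σ ((addHom F).onTerm (Term.func (f : (addLang F).Functions 2) ![s, t])) =
      Term.func ((addHom F).onFunction f)
        ![substTerm σ ((addHom F).onTerm s), substTerm σ ((addHom F).onTerm t)] := by
  refine congrArg (Term.func _) (funext fun i => ?_)
  fin_cases i <;> rfl

theorem substTerm_zeroOf {n m : ℕ} (σ : Fin n → (fullLang F).Term (Empty ⊕ Fin m)) :
    substTerm σ ((addHom F).onTerm zeroOf) = zeroT :=
  congrArg (Term.func _) (Subsingleton.elim _ _)

theorem substTerm_one {n m : ℕ} (σ : Fin n → (fullLang F).Term (Empty ⊕ Fin m)) :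
    substTerm σ ((addHom F).onTerm (Term.func (AddFunc.one : (addLang F).Functions 0) ![])) =
      oneT :=
  congrArg (Term.func _) (Subsingleton.elim _ _)

theorem substTerm_constOf (a : F) {n m : ℕ} (σ : Fin n → (fullLang F).Term (Empty ⊕ Fin m)) :
    substTerm σ ((addHom F).onTerm (constOf a)) = constT a := by
  rw [constOf, substTerm_func₁, substTerm_one]
  rfl

theorem substTerm_linearTerm :
    substTerm ![varX, mulT varX varX] ((addHom F).onTerm linearTerm) = quadT := by
  rw [linearTerm, substTerm_func₂, substTerm_func₂, substTerm_func₁, substTerm_one]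
  rfl

theorem substFormula_leOf {n m : ℕ} (σ : Fin n → (fullLang F).Term (Empty ⊕ Fin m))
    (s t : (addLang F).Term (Empty ⊕ Fin n)) :
    substFormula σ ((addHom F).onBoundedFormula (leOf OrdRel.lt s t)) =
      leF (substTerm σ ((addHom F).onTerm s)) (substTerm σ ((addHom F).onTerm t)) := by
  have h : (fun i => substTerm σ ((addHom F).onTerm (![s, t] i))) =
      ![substTerm σ ((addHom F).onTerm s), substTerm σ ((addHom F).onTerm t)] := by
    funext i
    fin_cases i <;> rfl
  rw [leF, ltF, ← h]
  rfl

/-! ### Derivations of the provable instances. -/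

theorem proves_quadGe {ε : F} (hε : (ε : ℝ) < 0) : Proves (theoryT F) (quadGe ε) := by
  obtain ⟨N, hN, hNδ⟩ := exists_two_div_le (neg_pos.2 hε)
  have h := proves_of_interpolant (gridFormula F N) (leOf OrdRel.lt (constOf ε) linearTerm)
    realize_gridFormula_sq fun x y hxy => by
      rw [realize_leOf_addLang, realize_constOf, realize_linearTerm]
      have := sq_nonneg (x - 1)
      rcases quad_lower_bound hN hxy with h | h <;> linarith
  rwa [substFormula_leOf, substTerm_constOf, substTerm_linearTerm] at h

theorem proves_quadNonnegBelow {r : F} (hr : (r : ℝ) < 1) :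
    Proves (theoryT F) (quadNonnegBelow r) := by
  -- $N$ is chosen with $2/N \le (1-r)^2$, and $(1-r)^2 \le (x-1)^2$ whenever $x \le r$.
  obtain ⟨N, hN, hNδ⟩ := exists_two_div_le (pow_pos (sub_pos.2 hr) 2)
  have h := proves_of_interpolant (gridFormula F N)
    ((leOf OrdRel.lt var₀ (constOf r)).imp (leOf OrdRel.lt zeroOf linearTerm))
    realize_gridFormula_sq fun x y hxy => by
      rw [BoundedFormula.realize_imp, realize_leOf_addLang, realize_leOf_addLang, realize_constOf,
        realize_linearTerm]
      intro hx
      have hx' : x ≤ r := hx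
      change 0 ≤ y - 2 * x + 1
      have : (1 - r : ℝ) ^ 2 ≤ (1 - x) ^ 2 := pow_le_pow_left₀ (sub_pos.2 hr).le (by linarith) 2
      rcases quad_lower_bound hN hxy with h | h <;> nlinarith
  rw [LHom.onBoundedFormula, substFormula, substFormula_leOf, substFormula_leOf, substTerm_constOf,
    substTerm_linearTerm, substTerm_zeroOf] at h
  exact h

theorem proves_quadNonnegAbove {r : F} (hr : 1 < (r : ℝ)) :
    Proves (theoryT F) (quadNonnegAbove r) := by
  obtain ⟨N, hN, hNδ⟩ := exists_two_div_le (pow_pos (sub_pos.2 hr) 2)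
  have h := proves_of_interpolant (gridFormula F N)
    ((leOf OrdRel.lt (constOf r) var₀).imp (leOf OrdRel.lt zeroOf linearTerm))
    realize_gridFormula_sq fun x y hxy => by
      rw [BoundedFormula.realize_imp, realize_leOf_addLang, realize_leOf_addLang, realize_constOf,
        realize_linearTerm]
      intro hx
      have hx' : r ≤ x := hx
      change 0 ≤ y - 2 * x + 1
      have : (r - 1 : ℝ) ^ 2 ≤ (x - 1) ^ 2 := pow_le_pow_left₀ (sub_pos.2 hr).le (by linarith) 2
      rcases quad_lower_bound hN hxy with h | h <;> linarith
  rw [LHom.onBoundedFormula, substFormula, substFormula_leOf, substFormula_leOf, substTerm_constOf,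
    substTerm_linearTerm, substTerm_zeroOf] at h
  exact h

end Interpolation

end RealFragments


theorem mainTheorem9 (F : Subfield ℝ) :
    ((∀ ε : F, RealFragments.Proves (RealFragments.theoryT F) (RealFragments.quadGe ε) ↔
        (ε : ℝ) < 0) ∧
      ¬ RealFragments.Proves (RealFragments.theoryT F) (RealFragments.quadNonneg F)) ∧
    ((∀ r : F, RealFragments.Proves (RealFragments.theoryT F) (RealFragments.quadNonnegBelow r) ↔
        (r : ℝ) < 1) ∧
      (∀ r : F, RealFragments.Proves (RealFragments.theoryT F) (RealFragments.quadNonnegAbove r) ↔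
        1 < (r : ℝ))) :=
  ⟨⟨fun _ => ⟨RealFragments.lt_zero_of_proves_quadGe, RealFragments.proves_quadGe⟩,
      RealFragments.not_proves_quadNonneg⟩,
    fun _ => ⟨RealFragments.lt_one_of_proves_quadNonnegBelow, RealFragments.proves_quadNonnegBelow⟩,
    fun _ => ⟨RealFragments.one_lt_of_proves_quadNonnegAbove, RealFragments.proves_quadNonnegAbove⟩⟩
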